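/- Let $k$ be a field and let $\mathcal C$ be a Schurian $k$-category, that is, a small $k$-linear category in which every space of morphisms ${}_y\mathcal C_x$ (from $x$ to $y$) has dimension $0$ or $1$. A walk in $\mathcal C$ is a non-empty sequence $(f_n,\epsilon_n),\dots,(f_1,\epsilon_1)$ of non-zero morphisms $f_i$ with signs $\epsilon_i=\pm1$, where $(f,-1)$ goes from the target of $f$ to its source, such that the target of each $(f_i,\epsilon_i)$ is the source of $(f_{i+1},\epsilon_{i+1})$. Assume that $\mathcal C$ is connected: any two objects are joined by a walk. A grading $X$ of $\mathcal C$ by a group $\Gamma_X$ is a decomposition ${}_y\mathcal C_x=\bigoplus_{s\in\Gamma_X}X^s{}_y\mathcal C_x$ for all objects $x,y$ such that $X^t{}_z\mathcal C_y\,X^s{}_y\mathcal C_x\subset X^{ts}{}_z\mathcal C_x$. A homogeneous walk has degree $\deg_X w=(\deg_X f_n)^{\epsilon_n}\cdots(\deg_X f_1)^{\epsilon_1}$, and $X$ is connected if for all objects $x,y$ and all $s\in\Gamma_X$ there is a homogeneous walk from $x$ to $y$ of degree $s$. Choose a non-zero morphism ${}_ye_x$ in each non-zero space ${}_y\mathcal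 C_x$, with ${}_xe_x=1_x$. The CW-complex $CW(\mathcal C)$ has the objects of $\mathcal C$ as $0$-cells, a $1$-cell from $x$ to $y$ for each ${}_ye_x$ with $x\neq y$, and a $2$-cell for each triple $(x,y,z)$ with $x\ne y$, $y\neq z$ and ${}_ze_y\,{}_ye_x\neq0$, attached along the $1$-cells ${}_ye_x$, ${}_ze_y$ and ${}_ze_x$ (the latter replaced by the constant path at $x$ if $z=x$). Every walk describes a path in $CW(\mathcal C)$: a non-zero morphism from $x$ to $y\ne x$ describes the $1$-cell ${}_ye_x$, a non-zero endomorphism describes a constant path, and $(f,-1)$ describes the reversed path. Let $X$ be a connected grading of $\mathcal C$, let $c_0$ be an object and let $u$ be a set of connector walks for $X$: for every object $x$ a homogeneous walk ${}_xu_{c_0}$ from $c_0$ to $x$ with $\deg_X{}_xu_{c_0}=1$, where ${}_{c_0}u_{c_0}=1_{c_0}$. Let $Z_{X,u}$ be the grading of $\mathcal C$ by $\pi_1(CW(\mathcal C),c_0)$ in which every non-zero morphism $f$ from $x$ to $y$ is homogeneous and its degree is the homotopy class of the loop described by the closed walk ${}_yu_{c_0}^{-1}\,f\,{}_xu_{c_0}$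 (walks, and products in $\pi_1$, are read from right to left). Then the grading $Z_{X,u}$ is connected. In particular, every element of $\pi_1(CW(\mathcal C),c_0)$ is the $Z_{X,u}$-degree of a closed walk at $c_0$ in $\mathcal C$. -/

import Mathlib

open CategoryTheory
open scoped unitInterval

noncomputable section

universe u v w

namespace SchurianCat

/-! ### Schurian categories, virtual morphisms and walks -/

/-- A `k`-linear category is Schurian if every space of morphisms has dimension zero or one. -/
def IsSchurian (k : Type w) [Field k] (C : Type u) [Category.{v} C] [Preadditive C]
    [Linear k C] : Prop :=
  ∀ x y : C, Module.rank k (x ⟶ y) = 0 ∨ Module.rank k (x ⟶ y) = 1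

/-- A virtual morphism from `x` to `y`: a non-zero morphism `f : x ⟶ y`, standing for `(f, 1)`,
or a non-zero morphism `f : y ⟶ x`, standing for `(f, -1)`. -/
inductive Virtual {C : Type u} [Category.{v} C] [Preadditive C] (x y : C) : Type v
  | pos (f : x ⟶ y) (hf : f ≠ 0) : Virtual x y
  | neg (f : y ⟶ x) (hf : f ≠ 0) : Virtual x y

/-- `(f, ε) ↦ (f, -ε)`. -/
def Virtual.inv {C : Type u} [Category.{v} C] [Preadditive C] {x y : C} :
    Virtual x y → Virtual y x
  | .pos f hf => .neg f hf
  | .neg f hf => .pos f hf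

/-- A walk from `x` to `y`: a (non-empty) sequence of virtual morphisms
`(f_n, ε_n), …, (f_1, ε_1)`, where the target of each is the source of the next one.
`snoc w v` performs `w` first and then `v`. -/
inductive Walk {C : Type u} [Category.{v} C] [Preadditive C] (x : C) : C → Type (max u v)
  | single {y : C} (v : Virtual x y) : Walk x y
  | snoc {y z : C} (w : Walk x y) (v : Virtual y z) : Walk x z

/-- Concatenation of walks: first `a`, then `b`. -/
def Walk.append {C : Type u} [Category.{v} C] [Preadditive C] {x y : C} (a : Walk x y) :
    {z : C} → Walk y z → Walk x z
  | _, .single v => .snoc a v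
  | _, .snoc b v => .snoc (a.append b) v

/-- The inverse walk. -/
def Walk.inv {C : Type u} [Category.{v} C] [Preadditive C] {x : C} :
    {y : C} → Walk x y → Walk y x
  | _, .single v => .single v.inv
  | _, .snoc w v => (Walk.single v.inv).append w.inv

/-- A category is connected if any two objects are joined by a walk. -/
def IsConnectedCategory (C : Type u) [Category.{v} C] [Preadditive C] : Prop :=
  ∀ x y : C, Nonempty (Walk x y)

/-! ### Gradings -/

/-- A grading of a `k`-category by a group `Γ`: each space of morphisms is the direct sum of its
homogeneous components (independent submodules that span the space), compatibly with
composition. -/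
structure Grading (k : Type*) [Field k] (C : Type u) [Category.{v} C] [Preadditive C]
    [Linear k C] (Γ : Type*) [Group Γ] where
  /-- the morphisms of degree `s` from `x` to `y` -/
  component : Γ → ∀ x y : C, Submodule k (x ⟶ y)
  independent : ∀ x y : C, iSupIndep fun s => component s x y
  iSup_eq_top : ∀ x y : C, ⨆ s, component s x y = ⊤
  comp_mem : ∀ {s t : Γ} {x y z : C} {f : x ⟶ y} {g : y ⟶ z},
    f ∈ component s x y → g ∈ component t y z → f ≫ g ∈ component (t * s) x z

section Degrees

variable {k : Type*} [Field k] {C : Type u} [Category.{v} C] [Preadditive C] [Linear k C]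
  {Γ : Type*} [Group Γ]

/-- The virtual morphism is homogeneous, of degree `s`. -/
def Grading.VirtualHasDegree (X : Grading k C Γ) {x y : C} : Virtual x y → Γ → Prop
  | .pos f _, s => f ∈ X.component s x y
  | .neg f _, s => f ∈ X.component s⁻¹ y x

/-- The walk is homogeneous and its degree (the ordered product of the degrees of its virtual
morphisms) is `s`. -/
def Grading.HasDegree (X : Grading k C Γ) {x : C} :
    {y : C} → Walk x y → Γ → Prop
  | _, .single v, s => X.VirtualHasDegree v s
  | _, .snoc w v, s => ∃ t r : Γ, X.VirtualHasDegree v t ∧ X.HasDegree w r ∧ s = t * r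

/-- A grading is connected if between any two objects there are homogeneous walks of all
degrees. -/
def Grading.IsConnected (X : Grading k C Γ) : Prop :=
  ∀ (x y : C) (s : Γ), ∃ w : Walk x y, X.HasDegree w s

/-- A set of connector walks for `X` at `c₀`: walks of degree one from `c₀` to all objects, the
one from `c₀` to itself being the identity morphism of `c₀`. -/
structure Connectors (X : Grading k C Γ) (c₀ : C) where
  walk : ∀ x : C, Walk c₀ x
  hasDegree_one : ∀ x : C, X.HasDegree (walk x) 1
  walk_self : ∃ h : 𝟙 c₀ ≠ 0, walk c₀ = .single (.pos (𝟙 c₀) h)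

end Degrees

/-! ### The CW-complex of a Schurian category -/

/-- A choice of a non-zero morphism `e x y` in each non-zero space of morphisms `x ⟶ y`, which is
the identity for `x = y`. -/
structure MorphismChoice (C : Type u) [Category.{v} C] [Preadditive C] where
  e : ∀ x y : C, x ⟶ y
  ne_zero : ∀ {x y : C} {f : x ⟶ y}, f ≠ 0 → e x y ≠ 0
  self : ∀ x : C, e x x = 𝟙 x

section CWComplex

variable {C : Type u} [Category.{v} C] [Preadditive C] (e : MorphismChoice C)

/-- The 1-cells: the chosen non-zero morphisms between distinct objects. -/
structure Edge where
  x : C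
  y : C
  ne : x ≠ y
  ne_zero : e.e x y ≠ 0

/-- The 2-cells: pairs of composable 1-cells with non-zero composition (`x = z` is allowed). -/
structure Face where
  x : C
  y : C
  z : C
  ne₁ : x ≠ y
  ne₂ : y ≠ z
  ne_zero₁ : e.e x y ≠ 0
  ne_zero₂ : e.e y z ≠ 0
  ne_zero₃ : e.e x z ≠ 0
  comp_ne_zero : e.e x y ≫ e.e y z ≠ 0

/-- The closed triangle with vertices `(0,0)`, `(1,0)`, `(1,1)`, as a model of the closed disk. -/
abbrev Triangle : Type := {p : I × I // p.2 ≤ p.1}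

/-- The side of the triangle from `(0,0)` to `(1,0)`. -/
def Triangle.side₁ (t : I) : Triangle := ⟨(t, 0), t.2.1⟩

/-- The side of the triangle from `(1,0)` to `(1,1)`. -/
def Triangle.side₂ (t : I) : Triangle := ⟨(1, t), t.2.2⟩

/-- The side of the triangle from `(0,0)` to `(1,1)`. -/
def Triangle.side₃ (t : I) : Triangle := ⟨(t, t), le_rfl⟩

/-- The disjoint union of a point for each object, a closed interval for each 1-cell and a closed
triangle for each 2-cell. -/
abbrev Cells : Type u :=
  (Σ _ : C, Unit) ⊕ (Σ _ : Edge e, I) ⊕ (Σ _ : Face e, Triangle)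

variable {e}

/-- The point of `Cells` given by an object. -/
def Cells.vertex (x : C) : Cells e := .inl ⟨x, ()⟩

/-- The points of the interval of a 1-cell. -/
def Cells.edge (E : Edge e) (t : I) : Cells e := .inr (.inl ⟨E, t⟩)

/-- The points of the triangle of a 2-cell. -/
def Cells.face (F : Face e) (p : Triangle) : Cells e := .inr (.inr ⟨F, p⟩)

variable (e)

/-- The attaching maps. The ends of a 1-cell are attached to its source and target. The three
sides of a 2-cell are attached to the 1-cells given by `x ⟶ y`, `y ⟶ z` and `x ⟶ z`; if `x = z`,
then the last of these morphisms is an identity and the third side is attached to the point `x`. -/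
inductive Attach : Cells e → Cells e → Prop
  | source (E : Edge e) : Attach (.edge E 0) (.vertex E.x)
  | target (E : Edge e) : Attach (.edge E 1) (.vertex E.y)
  | side₁ (F : Face e) (t : I) :
      Attach (.face F (Triangle.side₁ t)) (.edge ⟨F.x, F.y, F.ne₁, F.ne_zero₁⟩ t)
  | side₂ (F : Face e) (t : I) :
      Attach (.face F (Triangle.side₂ t)) (.edge ⟨F.y, F.z, F.ne₂, F.ne_zero₂⟩ t)
  | side₃ (F : Face e) (h : F.x ≠ F.z) (t : I) :
      Attach (.face F (Triangle.side₃ t)) (.edge ⟨F.x, F.z, h, F.ne_zero₃⟩ t)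
  | side₃_const (F : Face e) (h : F.x = F.z) (t : I) :
      Attach (.face F (Triangle.side₃ t)) (.vertex F.x)

/-- The CW-complex of the category: the quotient space of the disjoint union of the closed cells
by the attaching maps. -/
def CW : Type u := Quot (Attach e)

instance : TopologicalSpace (CW e) := inferInstanceAs (TopologicalSpace (Quot (Attach e)))

variable {e}

/-- The quotient map. -/
def CW.mk (p : Cells e) : CW e := Quot.mk (Attach e) p

theorem CW.continuous_mk : Continuous (CW.mk : Cells e → CW e) := continuous_quot_mk

variable (e)

/-- The 0-cell given by an object. -/
def CW.vertex (x : C) : CW e := CW.mk (.vertex x)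

/-- The path along a 1-cell. -/
def Edge.path {e : MorphismChoice C} (E : Edge e) : Path (CW.vertex e E.x) (CW.vertex e E.y) where
  toFun t := CW.mk (.edge E t)
  continuous_toFun := CW.continuous_mk.comp
    (continuous_inr.comp (continuous_inl.comp (continuous_sigmaMk (i := E))))
  source' := Quot.sound (.source E)
  target' := Quot.sound (.target E)

open Classical in
/-- The path described by the chosen morphism from `x` to `y`, when this morphism is non-zero:
the path along the 1-cell for `x ≠ y`, and a constant path for `x = y`. -/
def stepPath (x y : C) (h : e.e x y ≠ 0) : Path (CW.vertex e x) (CW.vertex e y) :=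
  if hxy : x = y then (Path.refl (CW.vertex e x)).cast rfl (by rw [hxy])
  else Edge.path (e := e) ⟨x, y, hxy, h⟩

/-- The path described by a virtual morphism. In a Schurian category a non-zero morphism is a
non-zero multiple of the chosen one. -/
def Virtual.path {x y : C} : Virtual x y → Path (CW.vertex e x) (CW.vertex e y)
  | .pos _ hf => stepPath e x y (e.ne_zero hf)
  | .neg _ hf => (stepPath e y x (e.ne_zero hf)).symm

/-- The path described by a walk. -/
def Walk.path {x : C} : {y : C} → Walk x y → Path (CW.vertex e x) (CW.vertex e y)
  | _, .single v => v.path e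
  | _, .snoc w v => (w.path).trans (v.path e)

/-- The homotopy class of the loop described by a closed walk. In the group structure of
`FundamentalGroup`, the product `p * q` is the class of `q` followed by `p`. -/
def Walk.homotopyClass {c₀ : C} (w : Walk c₀ c₀) : FundamentalGroup (CW e) (CW.vertex e c₀) :=
  FundamentalGroup.fromPath (Path.Homotopic.Quotient.mk (w.path e))

end CWComplex

/-! ### Helper facts for the grading by the fundamental group -/

section Helpers

variable {C : Type u} [Category.{v} C] [Preadditive C] (e : MorphismChoice C)

instance : ContractibleSpace Triangle := by
  rw [contractible_iff_id_nullhomotopic]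
  refine ⟨⟨(0, 0), le_rfl⟩, ⟨?_⟩⟩
  exact
    { toFun := fun q => ⟨(σ q.1 * q.2.1.1, σ q.1 * q.2.1.2),
        mul_le_mul_right q.2.2 _⟩
      continuous_toFun := by fun_prop
      map_zero_left := by rintro ⟨⟨a, b⟩, h⟩; simp
      map_one_left := by rintro ⟨⟨a, b⟩, h⟩; simp }

/-- The class of the path described by a walk, as a morphism of the fundamental groupoid. -/
def Walk.cls {x y : C} (w : Walk x y) :
    FundamentalGroupoid.mk (CW.vertex e x) ⟶ FundamentalGroupoid.mk (CW.vertex e y) :=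
  Path.Homotopic.Quotient.mk (w.path e)

theorem Walk.cls_snoc {x y z : C} (a : Walk x y) (v : Virtual y z) :
    (a.snoc v).cls e = a.cls e ≫ (Walk.single v).cls e := rfl

theorem Walk.cls_append {x y z : C} (a : Walk x y) (b : Walk y z) :
    (a.append b).cls e = a.cls e ≫ b.cls e := by
  induction b with
  | single v => rfl
  | snoc b v ih => rw [Walk.append, Walk.cls_snoc, ih, Walk.cls_snoc, Category.assoc]

theorem Walk.cls_single_inv {x y : C} (v : Virtual x y) :
    (Walk.single v.inv).cls e = Groupoid.inv ((Walk.single v).cls e) := by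
  cases v with
  | pos f hf => rfl
  | neg f hf =>
    change Path.Homotopic.Quotient.mk (stepPath e y x _)
      = Path.Homotopic.Quotient.mk (stepPath e y x _).symm.symm
    rw [Path.symm_symm]

theorem Walk.cls_inv {x y : C} (a : Walk x y) :
    a.inv.cls e = Groupoid.inv (a.cls e) := by
  induction a with
  | single v => exact Walk.cls_single_inv e v
  | snoc b v ih =>
    rw [Walk.inv, Walk.cls_append, ih, Walk.cls_single_inv, Walk.cls_snoc]
    simp

/-- The class of the path described by the chosen morphism. -/
def stepCls (x y : C) (h : e.e x y ≠ 0) :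
    FundamentalGroupoid.mk (CW.vertex e x) ⟶ FundamentalGroupoid.mk (CW.vertex e y) :=
  Path.Homotopic.Quotient.mk (stepPath e x y h)

theorem stepCls_self (x : C) (h : e.e x x ≠ 0) : stepCls e x x h = 𝟙 _ := by
  unfold stepCls stepPath
  rw [dif_pos rfl]
  rfl

/-- The sides of the 2-cells are homotopic. -/
theorem stepCls_comp {x y z : C} (h : e.e x y ≫ e.e y z ≠ 0) (h₁ : e.e x y ≠ 0)
    (h₂ : e.e y z ≠ 0) (h₃ : e.e x z ≠ 0) :
    stepCls e x y h₁ ≫ stepCls e y z h₂ = stepCls e x z h₃ := by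
  by_cases hxy : x = y
  · subst hxy
    rw [stepCls_self, Category.id_comp]
  by_cases hyz : y = z
  · subst hyz
    rw [stepCls_self, Category.comp_id]
  let F : Face e := ⟨x, y, z, hxy, hyz, h₁, h₂, h₃, h⟩
  let φ : Triangle → CW e := fun p => CW.mk (.face F p)
  have hφ : Continuous φ := CW.continuous_mk.comp
    (continuous_inr.comp (continuous_inr.comp (continuous_sigmaMk (i := F))))
  let P₁ : Path (⟨(0, 0), le_rfl⟩ : Triangle) ⟨(1, 0), zero_le_one⟩ :=
    { toFun := Triangle.side₁
      continuous_toFun := by unfold Triangle.side₁; fun_prop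
      source' := rfl
      target' := rfl }
  let P₂ : Path (⟨(1, 0), zero_le_one⟩ : Triangle) ⟨(1, 1), le_rfl⟩ :=
    { toFun := Triangle.side₂
      continuous_toFun := by unfold Triangle.side₂; fun_prop
      source' := rfl
      target' := rfl }
  let P₃ : Path (⟨(0, 0), le_rfl⟩ : Triangle) ⟨(1, 1), le_rfl⟩ :=
    { toFun := Triangle.side₃
      continuous_toFun := by unfold Triangle.side₃; fun_prop
      source' := rfl
      target' := rfl }
  have hP : (P₁.trans P₂).Homotopic P₃ := SimplyConnectedSpace.paths_homotopic _ _
  have e₁ : ∀ t, φ (P₁ t) = stepPath e x y h₁ t := fun t => by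
    unfold stepPath
    rw [dif_neg hxy]
    exact Quot.sound (.side₁ F t)
  have e₂ : ∀ t, φ (P₂ t) = stepPath e y z h₂ t := fun t => by
    unfold stepPath
    rw [dif_neg hyz]
    exact Quot.sound (.side₂ F t)
  have e₃ : ∀ t, φ (P₃ t) = stepPath e x z h₃ t := fun t => by
    unfold stepPath
    split_ifs with hxz
    · exact Quot.sound (.side₃_const F hxz t)
    · exact Quot.sound (.side₃ F hxz t)
  have vx : CW.vertex e x = φ ⟨(0, 0), le_rfl⟩ := by
    have := e₁ 0; simp only [Path.source] at this; exact this.symm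
  have vy : CW.vertex e y = φ ⟨(1, 0), zero_le_one⟩ := by
    have := e₁ 1; simp only [Path.target] at this; exact this.symm
  have vz : CW.vertex e z = φ ⟨(1, 1), le_rfl⟩ := by
    have := e₃ 1; simp only [Path.target] at this; exact this.symm
  have q₁ : stepPath e x y h₁ = (P₁.map hφ).cast vx vy := by ext t; exact (e₁ t).symm
  have q₂ : stepPath e y z h₂ = (P₂.map hφ).cast vy vz := by ext t; exact (e₂ t).symm
  have q₃ : stepPath e x z h₃ = (P₃.map hφ).cast vx vz := by ext t; exact (e₃ t).symm
  have key : ((stepPath e x y h₁).trans (stepPath e y z h₂)).Homotopic (stepPath e x z h₃) := by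
    have hm := hP.map ⟨φ, hφ⟩
    rw [q₁, q₂, q₃]
    have ht : ((P₁.map hφ).cast vx vy).trans ((P₂.map hφ).cast vy vz)
        = ((P₁.trans P₂).map hφ).cast vx vz := by
      rw [Path.map_trans]
      rfl
    rw [ht]
    obtain ⟨H⟩ := hm
    exact ⟨H.cast (by ext t; rfl) (by ext t; rfl)⟩
  exact Path.Homotopic.Quotient.eq.mpr key

end Helpers

/-! ### The grading by the fundamental group -/

section GradingZ

variable {k : Type*} [Field k] {C : Type u} [Category.{v} C] [Preadditive C] [Linear k C]
  {Γ : Type*} [Group Γ] {X : Grading k C Γ} {c₀ : C}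

/-- The closed walk at `c₀` given by the connector to `x`, a non-zero morphism `f : x ⟶ y` and
the inverse of the connector to `y`. -/
def Connectors.closedWalk (u : Connectors X c₀) {x y : C} (f : x ⟶ y) (hf : f ≠ 0) :
    Walk c₀ c₀ :=
  ((u.walk x).snoc (.pos f hf)).append (u.walk y).inv

theorem Connectors.homotopyClass_closedWalk (u : Connectors X c₀) (e : MorphismChoice C) {x y : C}
    (f : x ⟶ y) (hf : f ≠ 0) :
    (u.closedWalk f hf).homotopyClass e = ((u.walk x).cls e ≫ stepCls e x y (e.ne_zero hf)) ≫
      Groupoid.inv ((u.walk y).cls e) := by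
  change (u.closedWalk f hf).cls e = _
  rw [closedWalk, Walk.cls_append, Walk.cls_inv]
  rfl

theorem IsSchurian.exists_smul (hS : IsSchurian k C) (e : MorphismChoice C) {x y : C}
    (f : x ⟶ y) : ∃ a : k, f = a • e.e x y := by
  by_cases hf : f = 0
  · exact ⟨0, by simp [hf]⟩
  have h1 : Module.rank k (x ⟶ y) ≤ 1 := by
    rcases hS x y with h | h <;> simp [h]
  obtain ⟨v, hv⟩ := rank_le_one_iff.mp h1
  obtain ⟨a, ha⟩ := hv f
  obtain ⟨b, hb⟩ := hv (e.e x y)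
  have hb0 : b ≠ 0 := by
    rintro rfl
    exact e.ne_zero hf (by simp [← hb])
  exact ⟨a * b⁻¹, by rw [← hb, smul_smul, inv_mul_cancel_right₀ hb0, ha]⟩

/-- The morphisms of degree `s` of the grading `gradingZ` below. -/
def componentZ (e : MorphismChoice C) (u : Connectors X c₀)
    (s : FundamentalGroup (CW e) (CW.vertex e c₀)) (x y : C) : Submodule k (x ⟶ y) where
  carrier := {f | ∀ hf : f ≠ 0, (u.closedWalk f hf).homotopyClass e = s}
  zero_mem' := fun h => absurd rfl h
  add_mem' := fun {f g} hf hg h => by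
    by_cases h0 : f = 0
    · subst h0
      have h1 : g ≠ 0 := by simpa using h
      rw [← hg h1, u.homotopyClass_closedWalk, u.homotopyClass_closedWalk]
    · rw [← hf h0, u.homotopyClass_closedWalk, u.homotopyClass_closedWalk]
  smul_mem' := fun a f hf h => by
    have h0 : f ≠ 0 := by
      rintro rfl
      simp at h
    rw [← hf h0, u.homotopyClass_closedWalk, u.homotopyClass_closedWalk]

/-- The grading by the fundamental group of the CW-complex at `c₀` that is given by a set of
connector walks: the degree of a non-zero morphism `f : x ⟶ y` is the homotopy class of the loop
described by the connector to `x`, then `f`, then the inverse of the connector to `y`. -/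
def gradingZ (hS : IsSchurian k C) (e : MorphismChoice C) (X : Grading k C Γ)
    (u : Connectors X c₀) : Grading k C (FundamentalGroup (CW e) (CW.vertex e c₀)) where
  component := componentZ e u
  independent x y := by
    rw [iSupIndep_def]
    intro s
    rw [Submodule.disjoint_def]
    intro f hf hf'
    by_contra h0
    have hle : (⨆ t, ⨆ (_ : t ≠ s), componentZ e u t x y) ≤ ⊥ := by
      refine iSup₂_le fun t ht g hg => ?_
      by_contra hg0
      have hg1 : g ≠ 0 := hg0
      refine ht ?_
      rw [← hg hg1, ← hf h0, u.homotopyClass_closedWalk, u.homotopyClass_closedWalk]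
    exact h0 (hle hf')
  iSup_eq_top x y := by
    rw [eq_top_iff]
    intro f _
    by_cases h0 : f = 0
    · subst h0
      exact Submodule.zero_mem _
    · exact Submodule.mem_iSup_of_mem ((u.closedWalk f h0).homotopyClass e) fun _ => rfl
  comp_mem := fun {s t x y z f g} hf hg h => by
    have hf0 : f ≠ 0 := by
      rintro rfl
      simp at h
    have hg0 : g ≠ 0 := by
      rintro rfl
      simp at h
    have hc : e.e x y ≫ e.e y z ≠ 0 := by
      intro hc
      obtain ⟨a, ha⟩ := hS.exists_smul e f
      obtain ⟨b, hb⟩ := hS.exists_smul e g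
      exact h (by rw [ha, hb]; simp [hc])
    rw [← hf hf0, ← hg hg0]
    change _ = (u.closedWalk f hf0).homotopyClass e ≫ (u.closedWalk g hg0).homotopyClass e
    rw [u.homotopyClass_closedWalk, u.homotopyClass_closedWalk, u.homotopyClass_closedWalk,
      ← stepCls_comp e hc (e.ne_zero hf0) (e.ne_zero hg0)]
    simp

/-- The degree of a non-zero morphism for this grading. -/
theorem mem_gradingZ_component (hS : IsSchurian k C) (e : MorphismChoice C) (X : Grading k C Γ)
    (u : Connectors X c₀) {x y : C} (f : x ⟶ y) (hf : f ≠ 0)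
    (s : FundamentalGroup (CW e) (CW.vertex e c₀)) :
    f ∈ (gradingZ hS e X u).component s x y ↔ (u.closedWalk f hf).homotopyClass e = s :=
  ⟨fun h => h hf, fun h _ => h⟩

end GradingZ

end SchurianCat

end

/-!
For a walk `w` from `x` to `y`, the degree of `w` is the class
of the connector to `x`, then `w`, then the inverse of the connector to `y`
(`gradingZ_hasDegree`). Hence all degrees occur between `x` and `y` as soon as every homotopy class
of paths between two 0-cells is the class of a walk (`exists_walk_cls_eq`). This is edge-path
approximation, in a complex that may be infinite and is presented as a quotient of closed cells.

The barycentric coordinates of the closed cells fit together to a continuous function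
`CW.weight x` for each object `x`; here corners of a cell attached to the same 0-cell are added
up, which makes the coordinates compatible with the collapsed sides. The open stars
`CW.star e x = {q | 0 < q.weight x}` cover the complex. Shrinking all coordinates
other than that of `x` linearly, and scaling up the one of `x`, contracts the open star of `x`
within the complex to `x` (`CW.starHomotopy`); continuity holds because the product of a quotient
map with the unit interval is a quotient map. Therefore a path from `q` to `q'` in the open star of
`x` is homotopic to the radius from `q` to `x` followed by the inverse of the radius from `q'` to
`x` (`CW.cls_comp_radiusCls`).

By the Lebesgue number lemma, a path is a product of pieces in open stars. Where a piece in the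
star of `x` meets a piece in the star of `y`, the two radii form a path from `x` to `y` which lies
in one closed cell; as closed cells are simply connected, it is homotopic to a path along the
boundary of the cell, which is described by a walk
(`isWalkClass_inv_radiusCls_comp_radiusCls`).
-/

noncomputable section

namespace SchurianCat

/-! ### Barycentric coordinates -/

section Star

section Objects

variable {C : Type u}

open Classical in
/-- The barycentric coordinate with respect to the object `x`, at the object `y`. -/
def vertexWeight (x y : C) : ℝ := if y = x then 1 else 0

theorem vertexWeight_self (x : C) : vertexWeight x x = 1 := if_pos rfl

theorem vertexWeight_of_ne {x y : C} (h : y ≠ x) : vertexWeight x y = 0 := if_neg h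

theorem eq_of_vertexWeight_pos {x y : C} (h : 0 < vertexWeight x y) : y = x := by
  by_contra hne
  simp [vertexWeight_of_ne hne] at h

/-- The contraction of the open star of `x` moves each point linearly, in barycentric coordinates,
to the point whose coordinates with respect to the corners `x` are rescaled to have sum one and
whose other coordinates vanish. At time `s` the coordinate with respect to a corner `y` is
multiplied by this factor, where `l` is the barycentric coordinate with respect to `x`. -/
def starFactor (x y : C) (l : ℝ) (s : I) : ℝ := 1 - s + s * vertexWeight x y / l

theorem starFactor_zero (x y : C) (l : ℝ) : starFactor x y l 0 = 1 := by simp [starFactor]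

theorem starFactor_one (x y : C) (l : ℝ) : starFactor x y l 1 = vertexWeight x y / l := by
  simp [starFactor]

/-- The new barycentric coordinates have sum one. -/
theorem mul_starFactor_add_mul_starFactor {x y z : C} {t l : ℝ} (hl : 0 < l) (s : I)
    (h : l = (1 - t) * vertexWeight x y + t * vertexWeight x z) :
    (1 - t) * starFactor x y l s + t * starFactor x z l s = 1 := by
  have : (1 - t) * starFactor x y l s + t * starFactor x z l s =
      1 - s + s * ((1 - t) * vertexWeight x y + t * vertexWeight x z) / l := by
    unfold starFactor
    ring
  rw [this, ← h, mul_div_assoc, div_self hl.ne']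
  ring

end Objects

/-- The real number `r`, moved to the nearest point of the unit interval. -/
def clampI (r : ℝ) : I := Set.projIcc 0 1 zero_le_one r

theorem continuous_clampI : Continuous clampI :=
  continuous_projIcc (h := zero_le_one)

theorem clampI_coe (t : I) : clampI t = t := Set.projIcc_val zero_le_one t

theorem clampI_zero : clampI 0 = 0 := Set.projIcc_left zero_le_one

theorem clampI_one : clampI 1 = 1 := Set.projIcc_right zero_le_one

/-- The point `(a, b)`, moved into the triangle if necessary. -/
def clampTriangle (a b : ℝ) : Triangle := ⟨(clampI a, clampI b ⊓ clampI a), inf_le_right⟩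

theorem continuous_clampTriangle : Continuous fun p : ℝ × ℝ => clampTriangle p.1 p.2 := by
  refine Continuous.subtype_mk (Continuous.prodMk ?_ (Continuous.min ?_ ?_)) _
  · exact continuous_clampI.comp continuous_fst
  · exact continuous_clampI.comp continuous_snd
  · exact continuous_clampI.comp continuous_fst

theorem clampTriangle_coe (p : Triangle) : clampTriangle p.1.1 p.1.2 = p := by
  refine Subtype.ext (Prod.ext (clampI_coe _) ?_)
  simp only [clampTriangle, clampI_coe]
  exact inf_eq_left.2 p.2

theorem clampTriangle_zero_right (a : ℝ) : clampTriangle a 0 = Triangle.side₁ (clampI a) := by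
  refine Subtype.ext (Prod.ext rfl ?_)
  simp only [clampTriangle, clampI_zero]
  exact inf_eq_left.2 (clampI a).2.1

theorem clampTriangle_one_left (b : ℝ) : clampTriangle 1 b = Triangle.side₂ (clampI b) := by
  refine Subtype.ext (Prod.ext clampI_one ?_)
  simp only [clampTriangle, clampI_one]
  exact inf_eq_left.2 (clampI b).2.2

theorem clampTriangle_self (a : ℝ) : clampTriangle a a = Triangle.side₃ (clampI a) :=
  Subtype.ext (Prod.ext rfl (inf_idem _))

variable {C : Type u} [Category.{v} C] [Preadditive C] {e : MorphismChoice C}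

/-- The barycentric coordinate with respect to the object `x` on the disjoint union of the closed
cells. A point `(a, b)` of the triangle of a 2-cell has the coordinates `1 - a`, `a - b`, `b` with
respect to its three corners; corners with the same underlying object are added up. -/
def Cells.weight (x : C) : Cells e → ℝ
  | .inl ⟨y, _⟩ => vertexWeight x y
  | .inr (.inl ⟨E, t⟩) => (1 - t) * vertexWeight x E.x + t * vertexWeight x E.y
  | .inr (.inr ⟨F, p⟩) => (1 - p.1.1) * vertexWeight x F.x +
      (p.1.1 - p.1.2) * vertexWeight x F.y + p.1.2 * vertexWeight x F.z

theorem Cells.continuous_weight (x : C) : Continuous (Cells.weight (e := e) x) := by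
  refine continuous_sum_dom.2 ⟨?_, continuous_sum_dom.2 ⟨?_, ?_⟩⟩
  · exact continuous_sigma_iff.2 fun y => continuous_const
  · refine continuous_sigma_iff.2 fun E => ?_
    change Continuous fun t : I => (1 - (t : ℝ)) * vertexWeight x E.x + t * vertexWeight x E.y
    fun_prop
  · refine continuous_sigma_iff.2 fun F => ?_
    change Continuous fun p : Triangle => (1 - (p.1.1 : ℝ)) * vertexWeight x F.x +
      (p.1.1 - p.1.2) * vertexWeight x F.y + p.1.2 * vertexWeight x F.z
    fun_prop

theorem Cells.weight_eq_of_attach (x : C) {p q : Cells e} (h : Attach e p q) :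
    p.weight x = q.weight x := by
  cases h with
  | source E => simp [Cells.weight, Cells.edge, Cells.vertex]
  | target E => simp [Cells.weight, Cells.edge, Cells.vertex]
  | side₁ F t => simp [Cells.weight, Cells.edge, Cells.face, Triangle.side₁]
  | side₂ F t => simp [Cells.weight, Cells.edge, Cells.face, Triangle.side₂]
  | side₃ F h t => simp [Cells.weight, Cells.edge, Cells.face, Triangle.side₃]
  | side₃_const F h t =>
    simp only [Cells.weight, Cells.vertex, Cells.face, Triangle.side₃, ← h]
    ring

/-- Every point has a positive barycentric coordinate, as the coordinates of a point of a closed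
cell are nonnegative with sum one. -/
theorem Cells.exists_weight_pos (p : Cells e) : ∃ x : C, 0 < p.weight x := by
  have h0 : ∀ x y : C, 0 ≤ vertexWeight x y := fun x y => by
    unfold vertexWeight
    split_ifs <;> norm_num
  rcases p with ⟨y, _⟩ | ⟨E, t⟩ | ⟨F, ⟨⟨a, b⟩, hab⟩⟩
  · exact ⟨y, by simp [Cells.weight, vertexWeight_self]⟩
  · by_cases ht : (t : ℝ) = 0
    · exact ⟨E.x, by simp [Cells.weight, ht, vertexWeight_self]⟩
    · have h1 : 0 < (t : ℝ) := lt_of_le_of_ne t.2.1 (Ne.symm ht)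
      refine ⟨E.y, ?_⟩
      simp only [Cells.weight, vertexWeight_self]
      have := mul_nonneg (sub_nonneg.2 t.2.2) (h0 E.y E.x)
      linarith
  · have hab' : (b : ℝ) ≤ a := hab
    have ha : 0 ≤ 1 - (a : ℝ) := sub_nonneg.2 a.2.2
    have hb : 0 ≤ (b : ℝ) := b.2.1
    have hc : 0 ≤ (a : ℝ) - b := sub_nonneg.2 hab'
    have key : ∀ x : C, Cells.weight (e := e) x (.inr (.inr ⟨F, ⟨(a, b), hab⟩⟩)) =
        (1 - (a : ℝ)) * vertexWeight x F.x + (a - b) * vertexWeight x F.y +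
          b * vertexWeight x F.z := fun x => rfl
    by_contra! hle
    have hx := hle F.x
    have hy := hle F.y
    have hz := hle F.z
    rw [key] at hx hy hz
    simp only [vertexWeight_self] at hx hy hz
    have := mul_nonneg hc (h0 F.x F.y)
    have := mul_nonneg hb (h0 F.x F.z)
    have := mul_nonneg ha (h0 F.y F.x)
    have := mul_nonneg hb (h0 F.y F.z)
    have := mul_nonneg ha (h0 F.z F.x)
    have := mul_nonneg hc (h0 F.z F.y)
    linarith

/-- The barycentric coordinate with respect to the object `x` on the CW-complex. -/
def CW.weight (x : C) : CW e → ℝ :=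
  Quot.lift (Cells.weight x) fun _ _ h => Cells.weight_eq_of_attach x h

theorem CW.continuous_weight (x : C) : Continuous (CW.weight (e := e) x) :=
  continuous_quot_lift _ (Cells.continuous_weight x)

theorem CW.exists_weight_pos (q : CW e) : ∃ x : C, 0 < q.weight x := by
  induction q using Quot.ind with
  | mk p => exact p.exists_weight_pos

theorem CW.weight_vertex (x y : C) : (CW.vertex e y).weight x = vertexWeight x y := rfl

theorem CW.vertex_injective : Function.Injective (CW.vertex e) := fun x y h =>
  eq_of_vertexWeight_pos (by
    rw [← CW.weight_vertex (e := e), h, CW.weight_vertex, vertexWeight_self]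
    exact one_pos)

/-! ### The contraction of an open star -/

/-- The map contracting the open star of `x`, at the level of closed cells. Only its values on the
open star matter; there the new coordinates are those of a point of the cell, and the clamping
changes nothing. -/
def Cells.contract (x : C) (p : Cells e) (s : I) : Cells e :=
  match p with
  | .inl y => .inl y
  | .inr (.inl ⟨E, t⟩) =>
    .edge E (clampI (t * starFactor x E.y (Cells.weight x (.edge E t)) s))
  | .inr (.inr ⟨F, p⟩) =>
    .face F (clampTriangle
      (1 - (1 - p.1.1) * starFactor x F.x (Cells.weight x (.face F p)) s)
      (p.1.2 * starFactor x F.z (Cells.weight x (.face F p)) s))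

theorem Cells.contract_edge (x : C) (E : Edge e) (t s : I) :
    (Cells.edge E t).contract x s =
      .edge E (clampI (t * starFactor x E.y (Cells.weight x (.edge E t)) s)) := rfl

theorem Cells.contract_face (x : C) (F : Face e) (p : Triangle) (s : I) :
    (Cells.face F p).contract x s = .face F (clampTriangle
      (1 - (1 - p.1.1) * starFactor x F.x (Cells.weight x (.face F p)) s)
      (p.1.2 * starFactor x F.z (Cells.weight x (.face F p)) s)) := rfl

/-- The contraction is compatible with the attaching maps. -/
theorem Cells.mk_contract_eq_of_attach (x : C) {p q : Cells e} (h : Attach e p q)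
    (hp : 0 < p.weight x) (s : I) : CW.mk (p.contract x s) = CW.mk (q.contract x s) := by
  have hw := Cells.weight_eq_of_attach x h
  have hq := hw ▸ hp
  cases h with
  | source E =>
    rw [contract_edge, Set.Icc.coe_zero, zero_mul, clampI_zero]
    exact Quot.sound (.source E)
  | target E =>
    have h1 := mul_starFactor_add_mul_starFactor hp s (y := E.x) (z := E.y) (t := 1) rfl
    rw [sub_self, zero_mul, zero_add] at h1
    rw [contract_edge, Set.Icc.coe_one, h1, clampI_one]
    exact Quot.sound (.target E)
  | side₁ F t =>
    have h1 := mul_starFactor_add_mul_starFactor hq s (y := F.x) (z := F.y) (t := t) rfl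
    rw [contract_face, hw, contract_edge]
    simp only [Triangle.side₁, Set.Icc.coe_zero, zero_mul]
    rw [← eq_sub_of_add_eq' h1, clampTriangle_zero_right]
    exact Quot.sound (.side₁ F _)
  | side₂ F t =>
    rw [contract_face, hw, contract_edge]
    simp only [Triangle.side₂, Set.Icc.coe_one, sub_self, zero_mul, sub_zero]
    rw [clampTriangle_one_left]
    exact Quot.sound (.side₂ F _)
  | side₃ F h t =>
    have h1 := mul_starFactor_add_mul_starFactor hq s (y := F.x) (z := F.z) (t := t) rfl
    rw [contract_face, hw, contract_edge]
    simp only [Triangle.side₃]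
    rw [← eq_sub_of_add_eq' h1, clampTriangle_self]
    exact Quot.sound (.side₃ F h _)
  | side₃_const F h t =>
    have hl : Cells.weight x (.face F (Triangle.side₃ t)) =
        (1 - (t : ℝ)) * vertexWeight x F.x + t * vertexWeight x F.z := by
      simp [Cells.weight, Cells.face, Triangle.side₃]
    have h1 := mul_starFactor_add_mul_starFactor hp s hl
    rw [contract_face]
    have h2 : 1 - (1 - ((Triangle.side₃ t).1.1 : ℝ)) *
          starFactor x F.x (Cells.weight x (.face F (Triangle.side₃ t))) s =
        (Triangle.side₃ t).1.2 *
          starFactor x F.z (Cells.weight x (.face F (Triangle.side₃ t))) s :=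
      (eq_sub_of_add_eq' h1).symm
    rw [h2, clampTriangle_self]
    exact Quot.sound (.side₃_const F h _)

theorem Cells.contract_zero (x : C) (p : Cells e) : p.contract x 0 = p := by
  rcases p with y | ⟨E, t⟩ | ⟨F, p⟩
  · rfl
  · change (Cells.edge E t).contract x 0 = .edge E t
    rw [contract_edge, starFactor_zero, mul_one, clampI_coe]
  · change (Cells.face F p).contract x 0 = .face F p
    rw [contract_face, starFactor_zero, starFactor_zero, mul_one, mul_one, sub_sub_cancel,
      clampTriangle_coe]

/-- On a 1-cell, the contraction of the open star of `x` ends at an end of the 1-cell that is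
attached to `x`. -/
theorem Cells.contract_edge_one {x : C} {E : Edge e} {t : I}
    (h : 0 < Cells.weight x (.edge E t)) :
    (E.x = x ∧ (Cells.edge E t).contract x 1 = .edge E 0) ∨
      (E.y = x ∧ (Cells.edge E t).contract x 1 = .edge E 1) := by
  have hw : Cells.weight x (.edge E t) =
    (1 - (t : ℝ)) * vertexWeight x E.x + t * vertexWeight x E.y := rfl
  rw [contract_edge, starFactor_one]
  by_cases hy : E.y = x
  · have hx : E.x ≠ x := fun hx => E.ne (hx.trans hy.symm)
    rw [hw, vertexWeight_of_ne hx, hy, vertexWeight_self, mul_zero, zero_add, mul_one] at h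
    rw [hw, vertexWeight_of_ne hx, hy, vertexWeight_self, mul_zero, zero_add,
      mul_one, mul_one_div_cancel h.ne', clampI_one]
    exact .inr ⟨rfl, rfl⟩
  · rw [vertexWeight_of_ne hy, zero_div, mul_zero, clampI_zero]
    refine .inl ⟨?_, rfl⟩
    by_contra hx
    simp [hw, vertexWeight_of_ne hx, vertexWeight_of_ne hy] at h

/-- On a 2-cell, the contraction of the open star of `x` ends at a corner that is attached to `x`,
or on the third side of the triangle if this side is attached to the point `x`. -/
theorem Cells.contract_face_one {x : C} {F : Face e} {p : Triangle}
    (h : 0 < Cells.weight x (.face F p)) :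
    (F.x = x ∧ (Cells.face F p).contract x 1 = .face F (Triangle.side₁ 0)) ∨
      (F.y = x ∧ (Cells.face F p).contract x 1 = .face F (Triangle.side₁ 1)) ∨
      (F.z = x ∧ (Cells.face F p).contract x 1 = .face F (Triangle.side₂ 1)) ∨
      (F.x = F.z ∧ F.x = x ∧
        ∃ t, (Cells.face F p).contract x 1 = .face F (Triangle.side₃ t)) := by
  have hw : Cells.weight x (.face F p) = (1 - (p.1.1 : ℝ)) * vertexWeight x F.x +
      ((p.1.1 : ℝ) - p.1.2) * vertexWeight x F.y + p.1.2 * vertexWeight x F.z := rfl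
  rw [contract_face, starFactor_one, starFactor_one]
  by_cases hx : F.x = x
  · have hy : F.y ≠ x := fun hy => F.ne₁ (hx.trans hy.symm)
    by_cases hz : F.z = x
    · refine .inr (.inr (.inr ⟨hx.trans hz.symm, hx, ?_⟩))
      rw [hw, hx, hz, vertexWeight_of_ne hy, vertexWeight_self, mul_zero, add_zero, mul_one,
        mul_one] at h
      rw [hw, hx, hz, vertexWeight_of_ne hy, vertexWeight_self, mul_zero, add_zero, mul_one,
        mul_one]
      have h2 : 1 - (1 - (p.1.1 : ℝ)) * (1 / (1 - p.1.1 + p.1.2)) =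
          p.1.2 * (1 / (1 - p.1.1 + p.1.2)) := by
        field_simp [h.ne']
        ring
      rw [h2, clampTriangle_self]
      exact ⟨_, rfl⟩
    · rw [hw, hx, vertexWeight_of_ne hy, vertexWeight_of_ne hz, vertexWeight_self, mul_zero,
        mul_zero, add_zero, add_zero, mul_one] at h
      rw [hw, hx, vertexWeight_of_ne hy, vertexWeight_of_ne hz, vertexWeight_self, mul_zero,
        mul_zero, add_zero, add_zero, mul_one, mul_one_div_cancel h.ne', sub_self, zero_div,
        mul_zero, clampTriangle_zero_right, clampI_zero]
      exact .inl ⟨rfl, rfl⟩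
  · rw [vertexWeight_of_ne hx, zero_div, mul_zero, sub_zero, clampTriangle_one_left]
    by_cases hz : F.z = x
    · have hy : F.y ≠ x := fun hy => F.ne₂ (hy.trans hz.symm)
      rw [hw, hz, vertexWeight_of_ne hx, vertexWeight_of_ne hy, vertexWeight_self, mul_zero,
        mul_zero, add_zero, zero_add, mul_one] at h
      rw [hw, hz, vertexWeight_of_ne hx, vertexWeight_of_ne hy, vertexWeight_self, mul_zero,
        mul_zero, add_zero, zero_add, mul_one, mul_one_div_cancel h.ne', clampI_one]
      exact .inr (.inr (.inl ⟨rfl, rfl⟩))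
    · rw [vertexWeight_of_ne hz, zero_div, mul_zero, clampI_zero]
      refine .inr (.inl ⟨?_, rfl⟩)
      by_contra hy
      simp [hw, vertexWeight_of_ne hx, vertexWeight_of_ne hy, vertexWeight_of_ne hz] at h

end Star

section Contraction

/-! ### Null-homotopy of the open stars -/

theorem continuousAt_starFactor {C : Type u} (x y : C) {l : ℝ} (hl : 0 < l) (s : I) :
    ContinuousAt (fun q : ℝ × I => starFactor x y q.1 q.2) (l, s) := by
  unfold starFactor
  refine ContinuousAt.add (by fun_prop) (ContinuousAt.div (by fun_prop) (by fun_prop) hl.ne')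

variable {C : Type u} [Category.{v} C] [Preadditive C] {e : MorphismChoice C}

theorem Cells.isOpenEmbedding_edge (E : Edge e) : Topology.IsOpenEmbedding (Cells.edge E) :=
  Topology.IsOpenEmbedding.inr.comp (Topology.IsOpenEmbedding.inl.comp
    (show Topology.IsOpenEmbedding (Sigma.mk (β := fun _ : Edge e => I) E) from .sigmaMk))

theorem Cells.isOpenEmbedding_face (F : Face e) : Topology.IsOpenEmbedding (Cells.face F) :=
  Topology.IsOpenEmbedding.inr.comp (Topology.IsOpenEmbedding.inr.comp
    (show Topology.IsOpenEmbedding (Sigma.mk (β := fun _ : Face e => Triangle) F) from .sigmaMk))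

theorem Cells.continuous_edge (E : Edge e) : Continuous (Cells.edge E) :=
  (Cells.isOpenEmbedding_edge E).continuous

theorem Cells.continuous_face (F : Face e) : Continuous (Cells.face F) :=
  (Cells.isOpenEmbedding_face F).continuous

theorem Cells.continuousAt_contract (x : C) {p : Cells e} (hp : 0 < p.weight x) (s : I) :
    ContinuousAt (fun q : Cells e × I => q.1.contract x q.2) (p, s) := by
  rcases p with y | ⟨E, t⟩ | ⟨F, p⟩
  · have hi : Topology.IsOpenEmbedding
        (Prod.map (Sum.inl : _ → Cells e) (id : I → I)) :=
      Topology.IsOpenEmbedding.inl.prodMap .id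
    refine (hi.continuousAt_iff (x := (y, s))).1 ?_
    exact (continuous_inl.comp continuous_fst).continuousAt
  · have hi : Topology.IsOpenEmbedding (Prod.map (Cells.edge E) (id : I → I)) :=
      (Cells.isOpenEmbedding_edge E).prodMap .id
    refine (hi.continuousAt_iff (x := (t, s))).1 ?_
    refine (Cells.continuous_edge E).continuousAt.comp
      (continuous_clampI.continuousAt.comp (ContinuousAt.mul (by fun_prop) ?_))
    exact ContinuousAt.comp (x := (t, s)) (g := fun q : ℝ × I => starFactor x E.y q.1 q.2)
      (f := fun q : I × I => (Cells.weight x (.edge E q.1), q.2))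
      (continuousAt_starFactor x E.y hp s)
      (((Cells.continuous_weight x).comp
        ((Cells.continuous_edge E).comp continuous_fst)).prodMk continuous_snd).continuousAt
  · have hi : Topology.IsOpenEmbedding (Prod.map (Cells.face F) (id : I → I)) :=
      (Cells.isOpenEmbedding_face F).prodMap .id
    refine (hi.continuousAt_iff (x := (p, s))).1 ?_
    have hf : ∀ y : C, ContinuousAt (fun q : Triangle × I =>
        starFactor x y (Cells.weight x (.face F q.1)) q.2) (p, s) := fun y =>
      ContinuousAt.comp (x := (p, s)) (g := fun q : ℝ × I => starFactor x y q.1 q.2)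
        (f := fun q : Triangle × I => (Cells.weight x (.face F q.1), q.2))
        (continuousAt_starFactor x y hp s)
        (((Cells.continuous_weight x).comp
          ((Cells.continuous_face F).comp continuous_fst)).prodMk continuous_snd).continuousAt
    refine (Cells.continuous_face F).continuousAt.comp
      (continuous_clampTriangle.continuousAt.comp (ContinuousAt.prodMk ?_ ?_))
    · exact ContinuousAt.sub (by fun_prop) (ContinuousAt.mul (by fun_prop) (hf _))
    · exact ContinuousAt.mul (by fun_prop) (hf _)

open Classical in
/-- The map contracting the open star of `x` in the CW-complex, extended by the identity outside
of the open star. -/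
def CW.contract (x : C) (q : CW e) (s : I) : CW e :=
  Quot.lift (fun p : Cells e => if 0 < p.weight x then CW.mk (p.contract x s) else CW.mk p)
    (fun p p' h => by
      by_cases hp : 0 < p.weight x
      · have hp' : 0 < p'.weight x := Cells.weight_eq_of_attach x h ▸ hp
        simp only [if_pos hp, if_pos hp']
        exact Cells.mk_contract_eq_of_attach x h hp s
      · have hp' : ¬ 0 < p'.weight x := Cells.weight_eq_of_attach x h ▸ hp
        simp only [if_neg hp, if_neg hp']
        exact Quot.sound h) q

theorem CW.contract_mk (x : C) {p : Cells e} (hp : 0 < p.weight x) (s : I) :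
    (CW.mk p).contract x s = CW.mk (p.contract x s) := if_pos hp

variable (e) in
/-- The open star of the object `x` in the CW-complex. -/
def CW.star (x : C) : Set (CW e) := {q | 0 < q.weight x}

theorem CW.isOpen_star (x : C) : IsOpen (CW.star e x) :=
  isOpen_lt continuous_const (CW.continuous_weight x)

theorem CW.contract_zero (x : C) (q : CW e) (hq : q ∈ CW.star e x) : q.contract x 0 = q := by
  induction q using Quot.ind with
  | mk p => exact (CW.contract_mk x hq 0).trans (congrArg CW.mk (p.contract_zero x))

theorem CW.contract_one (x : C) (q : CW e) (hq : q ∈ CW.star e x) :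
    q.contract x 1 = CW.vertex e x := by
  induction q using Quot.ind with
  | mk p =>
    refine (CW.contract_mk x hq 1).trans ?_
    rcases p with ⟨y, _⟩ | ⟨E, t⟩ | ⟨F, p⟩
    · obtain rfl : y = x := eq_of_vertexWeight_pos hq
      rfl
    · obtain ⟨rfl, h⟩ | ⟨rfl, h⟩ := Cells.contract_edge_one hq
      · exact (congrArg CW.mk h).trans (Quot.sound (.source E))
      · exact (congrArg CW.mk h).trans (Quot.sound (.target E))
    · obtain ⟨rfl, h⟩ | ⟨rfl, h⟩ | ⟨rfl, h⟩ | ⟨hz, rfl, t, h⟩ := Cells.contract_face_one hq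
      · exact ((congrArg CW.mk h).trans (Quot.sound (.side₁ F 0))).trans
          (Quot.sound (.source _))
      · exact ((congrArg CW.mk h).trans (Quot.sound (.side₁ F 1))).trans
          (Quot.sound (.target _))
      · exact ((congrArg CW.mk h).trans (Quot.sound (.side₂ F 1))).trans
          (Quot.sound (.target _))
      · exact (congrArg CW.mk h).trans (Quot.sound (.side₃_const F hz t))

theorem CW.continuous_contract (x : C) :
    Continuous fun q : CW.star e x × I => (q.1 : CW e).contract x q.2 := by
  -- The product of the quotient map with the locally compact space `I` is a quotient map.
  have hq : Topology.IsQuotientMap ((CW.star e x).restrictPreimage CW.mk) :=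
    (isQuotientMap_quot_mk (r := Attach e)).restrictPreimage_isOpen (CW.isOpen_star x)
  refine hq.continuous_lift_prod_left (continuous_iff_continuousAt.2 fun ⟨⟨p, hp⟩, s⟩ => ?_)
  have hc : (fun q : (CW.mk ⁻¹' CW.star e x) × I =>
      (((CW.star e x).restrictPreimage CW.mk q.1 : CW.star e x) : CW e).contract x q.2) =
      fun q => CW.mk ((q.1 : Cells e).contract x q.2) :=
    funext fun q => CW.contract_mk x q.1.2 q.2
  rw [hc]
  exact CW.continuous_mk.continuousAt.comp (ContinuousAt.comp
    (x := ((⟨p, hp⟩ : CW.mk ⁻¹' CW.star e x), s))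
    (g := fun q : Cells e × I => q.1.contract x q.2)
    (f := fun q : (CW.mk ⁻¹' CW.star e x) × I => ((q.1 : Cells e), q.2))
    (Cells.continuousAt_contract x hp s) (by fun_prop))

variable (e) in
/-- The null-homotopy of the inclusion of the open star of `x`. -/
def CW.starHomotopy (x : C) :
    ContinuousMap.Homotopy (⟨Subtype.val, continuous_subtype_val⟩ : C(CW.star e x, CW e))
      (ContinuousMap.const _ (CW.vertex e x)) where
  toFun q := (q.2 : CW e).contract x q.1
  continuous_toFun := (CW.continuous_contract x).comp continuous_swap
  map_zero_left q := show q.1.contract x 0 = q.1 from CW.contract_zero x q.1 q.2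
  map_one_left q := show q.1.contract x 1 = CW.vertex e x from CW.contract_one x q.1 q.2

/-- The path from a point of the open star of `x` to `x` along which the point moves under the
contraction. -/
def CW.radius {x : C} {q : CW e} (hq : q ∈ CW.star e x) : Path q (CW.vertex e x) :=
  (CW.starHomotopy e x).evalAt ⟨q, hq⟩

/-- The class of `CW.radius`, as a morphism of the fundamental groupoid. -/
def CW.radiusCls {x : C} {q : CW e} (hq : q ∈ CW.star e x) :
    FundamentalGroupoid.mk q ⟶ FundamentalGroupoid.mk (CW.vertex e x) :=
  Path.Homotopic.Quotient.mk (CW.radius hq)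

/-- The class of a path in the open star of `x` is determined by the ends of the path. -/
theorem CW.cls_comp_radiusCls {x : C} {q q' : CW e} (γ : Path q q')
    (hγ : ∀ t, γ t ∈ CW.star e x) (hq : q ∈ CW.star e x) (hq' : q' ∈ CW.star e x) :
    (show FundamentalGroupoid.mk q ⟶ FundamentalGroupoid.mk q' from
      Path.Homotopic.Quotient.mk γ) ≫ CW.radiusCls hq' = CW.radiusCls hq := by
  let γ' : Path (⟨q, hq⟩ : CW.star e x) ⟨q', hq'⟩ :=
    { toFun := fun t => ⟨γ t, hγ t⟩
      continuous_toFun := by fun_prop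
      source' := Subtype.ext γ.source
      target' := Subtype.ext γ.target }
  have h := Path.Homotopic.map_trans_evalAt (CW.starHomotopy e x) γ'
  have h' : (show FundamentalGroupoid.mk q ⟶ FundamentalGroupoid.mk q' from
      Path.Homotopic.Quotient.mk γ) ≫ CW.radiusCls hq' = CW.radiusCls hq ≫ 𝟙 _ :=
    Path.Homotopic.Quotient.eq.2 h
  rw [h', Category.comp_id]

end Contraction

section WalkClasses

variable {C : Type u} [Category.{v} C] [Preadditive C] {e : MorphismChoice C}

/-! ### Classes of walks -/

/-- The class of a path, as a morphism of the fundamental groupoid. -/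
abbrev pathCls {X : Type*} [TopologicalSpace X] {p q : X} (γ : Path p q) :
    FundamentalGroupoid.mk p ⟶ FundamentalGroupoid.mk q :=
  Path.Homotopic.Quotient.mk γ

theorem pathCls_trans {X : Type*} [TopologicalSpace X] {p q r : X} (γ : Path p q)
    (δ : Path q r) : pathCls (γ.trans δ) = pathCls γ ≫ pathCls δ := rfl

/-- A morphism of the fundamental groupoid of the CW-complex which is the class of a walk. Its
source and target are arbitrary points that are equal to 0-cells, so that this makes sense for the
images of paths in the closed cells. -/
def IsWalkClass {p q : CW e} (f : FundamentalGroupoid.mk p ⟶ FundamentalGroupoid.mk q) : Prop :=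
  ∃ (x y : C) (hp : p = CW.vertex e x) (hq : q = CW.vertex e y) (w : Walk x y),
    f = pathCls ((w.path e).cast hp hq)

theorem isWalkClass_cls {x y : C} (w : Walk x y) : IsWalkClass (w.cls e) :=
  ⟨x, y, rfl, rfl, w, rfl⟩

theorem IsWalkClass.exists_walk {x y : C}
    {f : FundamentalGroupoid.mk (CW.vertex e x) ⟶ FundamentalGroupoid.mk (CW.vertex e y)}
    (hf : IsWalkClass f) : ∃ w : Walk x y, w.cls e = f := by
  obtain ⟨x', y', hp, hq, w, rfl⟩ := hf
  obtain rfl := CW.vertex_injective hp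
  obtain rfl := CW.vertex_injective hq
  exact ⟨w, rfl⟩

theorem IsWalkClass.cast {p q p' q' : CW e} {γ : Path p q} (h : IsWalkClass (pathCls γ))
    (hp : p' = p) (hq : q' = q) : IsWalkClass (pathCls (γ.cast hp hq)) := by
  subst hp hq
  exact h

theorem IsWalkClass.comp {p q r : CW e} {f : FundamentalGroupoid.mk p ⟶ FundamentalGroupoid.mk q}
    {g : FundamentalGroupoid.mk q ⟶ FundamentalGroupoid.mk r} (hf : IsWalkClass f)
    (hg : IsWalkClass g) : IsWalkClass (f ≫ g) := by
  obtain ⟨x, y, rfl, rfl, w, rfl⟩ := hf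
  obtain ⟨y', z, hq, rfl, w', rfl⟩ := hg
  obtain rfl := CW.vertex_injective hq
  exact ⟨x, z, rfl, rfl, w.append w', (Walk.cls_append e w w').symm⟩

theorem IsWalkClass.inv {p q : CW e} {f : FundamentalGroupoid.mk p ⟶ FundamentalGroupoid.mk q}
    (hf : IsWalkClass f) : IsWalkClass (Groupoid.inv f) := by
  obtain ⟨x, y, rfl, rfl, w, rfl⟩ := hf
  exact ⟨y, x, rfl, rfl, w.inv, (Walk.cls_inv e w).symm⟩

/-- An identity is the class of a walk that goes forth and back. -/
theorem isWalkClass_id (hC : IsConnectedCategory C) (x : C) :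
    IsWalkClass (𝟙 (FundamentalGroupoid.mk (CW.vertex e x))) := by
  obtain ⟨w⟩ := hC x x
  have h := (isWalkClass_cls (e := e) w).comp (isWalkClass_cls w).inv
  rwa [Groupoid.comp_inv] at h

/-! ### Paths in the closed cells -/

/-- All paths between the two given points of a closed cell describe classes of walks. -/
def MapsToWalks {K : Type*} [TopologicalSpace K] (φ : C(K, CW e)) (a b : K) : Prop :=
  ∀ γ : Path a b, IsWalkClass (pathCls (γ.map φ.continuous))

section

variable {K : Type*} [TopologicalSpace K] {φ : C(K, CW e)} {a b c : K}

theorem MapsToWalks.symm (h : MapsToWalks φ a b) : MapsToWalks φ b a := fun γ => by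
  have := (h γ.symm).inv
  rwa [show Groupoid.inv (pathCls (γ.symm.map φ.continuous)) = pathCls (γ.map φ.continuous) from
    congrArg pathCls (Path.symm_symm (γ.map φ.continuous))] at this

variable [SimplyConnectedSpace K]

theorem mapsToWalks_of_path (γ : Path a b) (h : IsWalkClass (pathCls (γ.map φ.continuous))) :
    MapsToWalks φ a b := fun δ => by
  have hδ : pathCls (δ.map φ.continuous) = pathCls (γ.map φ.continuous) :=
    Path.Homotopic.Quotient.eq.2 ((SimplyConnectedSpace.paths_homotopic δ γ).map φ)
  rwa [hδ]

theorem MapsToWalks.trans (hab : MapsToWalks φ a b) (hbc : MapsToWalks φ b c) :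
    MapsToWalks φ a c := by
  refine mapsToWalks_of_path
    ((PathConnectedSpace.somePath a b).trans (PathConnectedSpace.somePath b c)) ?_
  rw [Path.map_trans, pathCls_trans]
  exact (hab _).comp (hbc _)

end

instance : SimplyConnectedSpace I :=
  haveI : ContractibleSpace I := (convex_Icc (0 : ℝ) 1).contractibleSpace ⟨0, by simp⟩
  inferInstance

/-- The characteristic map of a 1-cell. -/
def Edge.map (E : Edge e) : C(I, CW e) :=
  ⟨fun t => CW.mk (.edge E t), CW.continuous_mk.comp (Cells.continuous_edge E)⟩

/-- The characteristic map of a 2-cell. -/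
def Face.map (F : Face e) : C(Triangle, CW e) :=
  ⟨fun p => CW.mk (.face F p), CW.continuous_mk.comp (Cells.continuous_face F)⟩

theorem isWalkClass_edge_path (E : Edge e) : IsWalkClass (pathCls E.path) := by
  refine ⟨E.x, E.y, rfl, rfl, .single (.pos (e.e E.x E.y) E.ne_zero), ?_⟩
  change pathCls E.path = pathCls (stepPath e E.x E.y E.ne_zero)
  rw [stepPath, dif_neg E.ne]

theorem Edge.mapsToWalks (E : Edge e) : MapsToWalks E.map 0 1 := by
  refine mapsToWalks_of_path ⟨.id I, rfl, rfl⟩ ?_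
  exact (isWalkClass_edge_path E).cast (Quot.sound (.source E)) (Quot.sound (.target E))

/-- If a path in the triangle of a 2-cell runs along a 1-cell, then it describes the class of a
walk. -/
theorem Face.mapsToWalks_of_edge (F : Face e) (E : Edge e) {a b : Triangle} (γ : Path a b)
    (h : ∀ t, F.map (γ t) = E.map t) : MapsToWalks F.map a b := by
  refine mapsToWalks_of_path γ ?_
  have ha : F.map a = E.map 0 := by rw [← h, γ.source]
  have hb : F.map b = E.map 1 := by rw [← h, γ.target]
  have hγ : γ.map F.map.continuous =
      ((⟨.id I, rfl, rfl⟩ : Path (0 : I) 1).map E.map.continuous).cast ha hb :=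
    Path.ext (funext h)
  rw [hγ]
  exact (E.mapsToWalks _).cast ha hb

theorem Face.mapsToWalks_side₁ (F : Face e) :
    MapsToWalks F.map (Triangle.side₁ 0) (Triangle.side₁ 1) :=
  F.mapsToWalks_of_edge ⟨F.x, F.y, F.ne₁, F.ne_zero₁⟩
    { toFun := Triangle.side₁
      continuous_toFun := by unfold Triangle.side₁; fun_prop
      source' := rfl
      target' := rfl } fun t => Quot.sound (.side₁ F t)

theorem Face.mapsToWalks_side₂ (F : Face e) :
    MapsToWalks F.map (Triangle.side₁ 1) (Triangle.side₂ 1) :=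
  F.mapsToWalks_of_edge ⟨F.y, F.z, F.ne₂, F.ne_zero₂⟩
    { toFun := Triangle.side₂
      continuous_toFun := by unfold Triangle.side₂; fun_prop
      source' := rfl
      target' := rfl } fun t => Quot.sound (.side₂ F t)

/-- The third side of a 2-cell with `x = z` is attached to a point. -/
theorem Face.mapsToWalks_side₃ (hC : IsConnectedCategory C) (F : Face e) (h : F.x = F.z) (t : I) :
    MapsToWalks F.map (Triangle.side₁ 0) (Triangle.side₃ t) := by
  let γ : Path (Triangle.side₁ 0) (Triangle.side₃ t) :=
    { toFun := fun s => Triangle.side₃ (s * t)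
      continuous_toFun := by unfold Triangle.side₃; fun_prop
      source' := by simp only [zero_mul]; rfl
      target' := by simp only [one_mul] }
  refine mapsToWalks_of_path γ ?_
  have ha : ∀ s, F.map (Triangle.side₃ s) = CW.vertex e F.x := fun s =>
    Quot.sound (.side₃_const F h s)
  have hγ : γ.map F.map.continuous = (Path.refl (CW.vertex e F.x)).cast (ha 0) (ha t) :=
    Path.ext (funext fun s => ha _)
  rw [hγ]
  exact IsWalkClass.cast (isWalkClass_id hC F.x) (ha 0) (ha t)

/-- Two radii at the same point that lift to the same closed cell differ by the class of a walk, if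
the ends of the lifts do. -/
theorem isWalkClass_inv_comp {K : Type*} [TopologicalSpace K] {φ : C(K, CW e)} {p a b : K}
    (hab : MapsToWalks φ a b) (γ : Path p a) (δ : Path p b) {p' a' b' : CW e} (γ' : Path p' a')
    (δ' : Path p' b') (hγ : ∀ t, γ' t = φ (γ t)) (hδ : ∀ t, δ' t = φ (δ t)) :
    IsWalkClass (Groupoid.inv (pathCls γ') ≫ pathCls δ') := by
  obtain rfl : p' = φ p := by simpa using hγ 0
  obtain rfl : a' = φ a := by simpa using hγ 1
  obtain rfl : b' = φ b := by simpa using hδ 1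
  obtain rfl : γ' = γ.map φ.continuous := Path.ext (funext hγ)
  obtain rfl : δ' = δ.map φ.continuous := Path.ext (funext hδ)
  have h := hab (γ.symm.trans δ)
  rwa [Path.map_trans, pathCls_trans] at h

/-- At a common point of the open stars of `x` and `y`, the radii to `x` and `y` differ by the
class of a walk. -/
theorem isWalkClass_inv_radiusCls_comp_radiusCls (hC : IsConnectedCategory C) {x y : C} {q : CW e}
    (hx : q ∈ CW.star e x) (hy : q ∈ CW.star e y) :
    IsWalkClass (Groupoid.inv (CW.radiusCls hx) ≫ CW.radiusCls hy) := by
  induction q using Quot.ind with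
  | mk p =>
  rcases p with ⟨z, _⟩ | ⟨E, t⟩ | ⟨F, p⟩
  · obtain rfl : z = x := eq_of_vertexWeight_pos hx
    obtain rfl : z = y := eq_of_vertexWeight_pos hy
    rw [Groupoid.inv_comp]
    exact isWalkClass_id hC z
  -- In both remaining cases, `r x` is the lift of the radius to `x`, a path in the closed cell.
  · let r : C → I → I := fun x s =>
      clampI (t * starFactor x E.y (Cells.weight x (.edge E t)) s)
    have hr : ∀ x, 0 < Cells.weight x (.edge E t) → ∃ γ : Path t (r x 1), ∀ s, γ s = r x s := by
      intro x hx
      refine ⟨⟨⟨r x, ?_⟩, ?_, rfl⟩, fun s => rfl⟩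
      · change Continuous fun s : I =>
          clampI (t * starFactor x E.y (Cells.weight x (.edge E t)) s)
        refine continuous_clampI.comp ?_
        unfold starFactor
        fun_prop
      · change clampI _ = t
        rw [starFactor_zero, mul_one, clampI_coe]
    have hE : ∀ x, 0 < Cells.weight x (.edge E t) → MapsToWalks E.map 0 (r x 1) := by
      intro x hx
      have hinj := (Cells.isOpenEmbedding_edge E).injective
      obtain ⟨-, h⟩ | ⟨-, h⟩ := Cells.contract_edge_one hx
      · rw [show r x 1 = 0 from hinj h]
        exact E.mapsToWalks.trans E.mapsToWalks.symm
      · rw [show r x 1 = 1 from hinj h]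
        exact E.mapsToWalks
    obtain ⟨γ, hγ⟩ := hr x hx
    obtain ⟨δ, hδ⟩ := hr y hy
    refine isWalkClass_inv_comp ((hE x hx).symm.trans (hE y hy)) γ δ _ _ (fun s => ?_)
      fun s => ?_
    · rw [hγ]
      exact CW.contract_mk (p := .edge E t) x hx s
    · rw [hδ]
      exact CW.contract_mk (p := .edge E t) y hy s
  · let r : C → I → Triangle := fun x s => clampTriangle
      (1 - (1 - p.1.1) * starFactor x F.x (Cells.weight x (.face F p)) s)
      (p.1.2 * starFactor x F.z (Cells.weight x (.face F p)) s)
    have hr : ∀ x, 0 < Cells.weight x (.face F p) → ∃ γ : Path p (r x 1), ∀ s, γ s = r x s := by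
      intro x hx
      refine ⟨⟨⟨r x, ?_⟩, ?_, rfl⟩, fun s => rfl⟩
      · change Continuous fun s : I => clampTriangle
          (1 - (1 - p.1.1) * starFactor x F.x (Cells.weight x (.face F p)) s)
          (p.1.2 * starFactor x F.z (Cells.weight x (.face F p)) s)
        refine continuous_clampTriangle.comp (f := fun s : I =>
          (1 - (1 - (p.1.1 : ℝ)) * starFactor x F.x (Cells.weight x (.face F p)) s,
            p.1.2 * starFactor x F.z (Cells.weight x (.face F p)) s)) ?_
        unfold starFactor
        fun_prop
      · change clampTriangle _ _ = p
        rw [starFactor_zero, starFactor_zero, mul_one, mul_one, sub_sub_cancel,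
          clampTriangle_coe]
    have hF : ∀ x, 0 < Cells.weight x (.face F p) →
        MapsToWalks F.map (Triangle.side₁ 0) (r x 1) := by
      intro x hx
      have hinj := (Cells.isOpenEmbedding_face F).injective
      have h₁ := F.mapsToWalks_side₁
      obtain ⟨-, h⟩ | ⟨-, h⟩ | ⟨-, h⟩ | ⟨hz, -, t, h⟩ := Cells.contract_face_one hx
      · rw [show r x 1 = Triangle.side₁ 0 from hinj h]
        exact h₁.trans h₁.symm
      · rw [show r x 1 = Triangle.side₁ 1 from hinj h]
        exact h₁
      · rw [show r x 1 = Triangle.side₂ 1 from hinj h]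
        exact h₁.trans F.mapsToWalks_side₂
      · rw [show r x 1 = Triangle.side₃ t from hinj h]
        exact F.mapsToWalks_side₃ hC hz t
    obtain ⟨γ, hγ⟩ := hr x hx
    obtain ⟨δ, hδ⟩ := hr y hy
    refine isWalkClass_inv_comp ((hF x hx).symm.trans (hF y hy)) γ δ _ _ (fun s => ?_)
      fun s => ?_
    · rw [hγ]
      exact CW.contract_mk (p := .face F p) x hx s
    · rw [hδ]
      exact CW.contract_mk (p := .face F p) y hy s

/-! ### Edge-path approximation -/

theorem CW.vertex_mem_star (x : C) : CW.vertex e x ∈ CW.star e x := by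
  change 0 < vertexWeight x x
  rw [vertexWeight_self]
  exact one_pos

theorem CW.radiusCls_vertex {x : C} : CW.radiusCls (CW.vertex_mem_star (e := e) x) = 𝟙 _ :=
  congrArg pathCls (Path.ext (funext fun s =>
    CW.contract_mk (p := .vertex x) x (CW.vertex_mem_star (e := e) x) s) :
    CW.radius (CW.vertex_mem_star (e := e) x) = Path.refl _)

theorem isWalkClass_radiusCls (hC : IsConnectedCategory C) {x z : C} {q : CW e}
    (hq : q = CW.vertex e x) (hz : q ∈ CW.star e z) : IsWalkClass (CW.radiusCls hz) := by
  subst hq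
  obtain rfl : x = z := eq_of_vertexWeight_pos hz
  rw [CW.radiusCls_vertex]
  exact isWalkClass_id hC x

/-- Every path between 0-cells is homotopic to the path described by a walk: the path is subdivided
into pieces each of which lies in the open star of a 0-cell. -/
theorem exists_walk_cls_eq (hC : IsConnectedCategory C) {x y : C}
    (f : FundamentalGroupoid.mk (CW.vertex e x) ⟶ FundamentalGroupoid.mk (CW.vertex e y)) :
    ∃ w : Walk x y, w.cls e = f := by
  refine IsWalkClass.exists_walk ?_
  obtain ⟨γ, rfl⟩ := Path.Homotopic.Quotient.mk_surjective f
  obtain ⟨t, ht0, htm, ⟨N, hN⟩, ht⟩ := exists_monotone_Icc_subset_open_cover_unitInterval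
    (c := fun z : C => γ ⁻¹' CW.star e z)
    (fun z => (CW.isOpen_star z).preimage γ.continuous)
    (fun s _ => Set.mem_iUnion.2 (CW.exists_weight_pos (γ s)))
  -- The initial piece of the path, followed by any radius at its end, is the class of a walk.
  have key : ∀ n (z : C) (hz : γ (t n) ∈ CW.star e z),
      IsWalkClass (pathCls (γ.subpath 0 (t n)) ≫ CW.radiusCls hz) := by
    intro n
    induction n with
    | zero =>
      rw [ht0]
      intro z hz
      rw [Path.subpath_self]
      exact (Category.id_comp (CW.radiusCls hz)).symm ▸ isWalkClass_radiusCls hC γ.source hz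
    | succ n ih =>
      intro z hz
      obtain ⟨i, hi⟩ := ht n
      have hle := htm (Nat.le_succ n)
      have h0 : γ (t n) ∈ CW.star e i := hi ⟨le_rfl, hle⟩
      have h1 : γ (t (n + 1)) ∈ CW.star e i := hi ⟨hle, le_rfl⟩
      have hsub : pathCls (γ.subpath (t n) (t (n + 1))) =
          CW.radiusCls h0 ≫ Groupoid.inv (CW.radiusCls h1) := by
        rw [← CW.cls_comp_radiusCls (γ.subpath (t n) (t (n + 1))) (fun s => ?_) h0 h1,
          Category.assoc, Groupoid.comp_inv, Category.comp_id]
        have hs := Set.mem_range_self (f := γ.subpath (t n) (t (n + 1))) s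
        rw [Path.range_subpath_of_le _ _ _ hle] at hs
        obtain ⟨s', hs', h⟩ := hs
        rw [← h]
        exact hi hs'
      have htr : pathCls (γ.subpath 0 (t (n + 1))) =
          pathCls (γ.subpath 0 (t n)) ≫ pathCls (γ.subpath (t n) (t (n + 1))) :=
        (Path.Homotopic.Quotient.eq.2 ⟨Path.Homotopy.subpathTransSubpath γ _ _ _⟩).symm
      have h := (ih i h0).comp (isWalkClass_inv_radiusCls_comp_radiusCls hC h1 hz)
      rw [htr, hsub]
      simpa only [Category.assoc] using h
  have h1 : γ (t N) = CW.vertex e y := by rw [hN N le_rfl, γ.target]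
  obtain ⟨z, hz⟩ := CW.exists_weight_pos (γ (t N))
  have h := (key N z hz).comp (isWalkClass_radiusCls hC h1 hz).inv
  rw [Category.assoc, Groupoid.comp_inv, Category.comp_id, hN N le_rfl, Path.subpath_zero_one] at h
  exact h.cast γ.source.symm γ.target.symm

end WalkClasses

/-! ### Degrees of walks -/

section Degree

variable {k : Type*} [Field k] {C : Type u} [Category.{v} C] [Preadditive C] [Linear k C]
  {Γ : Type*} [Group Γ] {X : Grading k C Γ} {c₀ : C}

/-- Every walk is homogeneous for the grading by the fundamental group; its degree is the class of
the loop that it describes together with the connectors. -/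
theorem gradingZ_hasDegree (hS : IsSchurian k C) (e : MorphismChoice C) (u : Connectors X c₀)
    {x y : C} (w : Walk x y) :
    (gradingZ hS e X u).HasDegree w
      (((u.walk x).cls e ≫ w.cls e) ≫ Groupoid.inv ((u.walk y).cls e)) := by
  have hv : ∀ {x y : C} (v : Virtual x y), (gradingZ hS e X u).VirtualHasDegree v
      (((u.walk x).cls e ≫ (Walk.single v).cls e) ≫ Groupoid.inv ((u.walk y).cls e)) := by
    intro x y v
    cases v with
    | pos f hf =>
      exact (mem_gradingZ_component hS e X u f hf _).2 (u.homotopyClass_closedWalk e f hf)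
    | neg f hf =>
      refine (mem_gradingZ_component hS e X u f hf _).2 ?_
      rw [u.homotopyClass_closedWalk e f hf]
      change _ = Groupoid.inv (((u.walk x).cls e ≫ Groupoid.inv (stepCls e y x (e.ne_zero hf))) ≫
        Groupoid.inv ((u.walk y).cls e))
      simp
  induction w with
  | single v => exact hv v
  | snoc w v ih =>
    refine ⟨_, _, hv v, ih, ?_⟩
    rw [Walk.cls_snoc, End.mul_def]
    simp

theorem gradingZ_isConnected (hS : IsSchurian k C) (hC : IsConnectedCategory C)
    (e : MorphismChoice C) (u : Connectors X c₀) : (gradingZ hS e X u).IsConnected := by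
  intro x y s
  obtain ⟨w, hw⟩ := exists_walk_cls_eq hC
    ((Groupoid.inv ((u.walk x).cls e) ≫ FundamentalGroup.toArrow s) ≫ (u.walk y).cls e)
  refine ⟨w, ?_⟩
  have h := gradingZ_hasDegree hS e u w
  rw [hw] at h
  simpa using h

end Degree

end SchurianCat

end

theorem mainTheorem4 {k : Type*} [Field k] {C : Type*} [CategoryTheory.Category C]
    [CategoryTheory.Preadditive C] [CategoryTheory.Linear k C]
    (hS : SchurianCat.IsSchurian k C) (hC : SchurianCat.IsConnectedCategory C)
    (e : SchurianCat.MorphismChoice C)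
    {Γ : Type*} [Group Γ] (X : SchurianCat.Grading k C Γ) (hX : X.IsConnected)
    (c₀ : C) (u : SchurianCat.Connectors X c₀) :
    (SchurianCat.gradingZ hS e X u).IsConnected ∧
      ∀ g : FundamentalGroup (SchurianCat.CW e) (SchurianCat.CW.vertex e c₀),
        ∃ w : SchurianCat.Walk c₀ c₀, (SchurianCat.gradingZ hS e X u).HasDegree w g := by
  have h := SchurianCat.gradingZ_isConnected hS hC e u
  exact ⟨h, h c₀ c₀⟩
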